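/- Let $d\ge 1$ be an integer, and let $|\psi\rangle$ be a uniformly random unit vector in $\mathbb{C}^d\otimes\mathbb{C}^d$, i.e. distributed according to the unitarily invariant probability measure on the unit sphere. Let $\psi^A=\operatorname{tr}_B|\psi\rangle\langle\psi|$ be its reduced state on the first factor, let $\|\cdot\|_\infty$ denote the operator norm (so $\|\psi^A\|_\infty$ is the largest eigenvalue of $\psi^A$), and set $\gamma_0=\frac{16}{e\,d}$. Then for every real number $\epsilon$, $$\Pr_\psi\left\{\|\psi^A\|_\infty\ge \gamma_0\,e^{\epsilon}\right\}\le e^{-d\epsilon}.$$ -/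

import Mathlib

open MeasureTheory

noncomputable section

/-- The Hilbert space `ℂ^d ⊗ ℂ^d`, in coordinates with respect to the product basis
`|i⟩ ⊗ |j⟩`, `i, j < d`. -/
abbrev BipartiteSpace (d : ℕ) : Type := EuclideanSpace ℂ (Fin d × Fin d)

/-- Pure state vectors: the unit vectors of `ℂ^d ⊗ ℂ^d`. -/
abbrev PureState (d : ℕ) : Type := Metric.sphere (0 : BipartiteSpace d) 1

/-- The uniform distribution on pure states: the surface measure of the unit sphere,
normalized to total mass one. It is a unitarily invariant probability measure, see
`uniformPureState_isProbabilityMeasure` and `uniformPureState_map_unitary`. -/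
def uniformPureState (d : ℕ) : Measure (PureState d) :=
  ((Measure.addHaar : Measure (BipartiteSpace d)).toSphere Set.univ)⁻¹ •
    (Measure.addHaar : Measure (BipartiteSpace d)).toSphere

/-- The density matrix `|ψ⟩⟨ψ|`. -/
def densityMatrix {d : ℕ} (ψ : BipartiteSpace d) : Matrix (Fin d × Fin d) (Fin d × Fin d) ℂ :=
  Matrix.of fun p q => ψ p * star (ψ q)

/-- The partial trace over the second tensor factor. -/
def partialTraceB {d : ℕ} (ρ : Matrix (Fin d × Fin d) (Fin d × Fin d) ℂ) :
    Matrix (Fin d) (Fin d) ℂ :=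
  Matrix.of fun i j => ∑ k, ρ (i, k) (j, k)

/-- The reduced state `ψ^A = tr_B |ψ⟩⟨ψ|`. -/
def reducedState {d : ℕ} (ψ : BipartiteSpace d) : Matrix (Fin d) (Fin d) ℂ :=
  partialTraceB (densityMatrix ψ)

/-- The norm `‖M‖_∞`: the operator norm of `M` as an operator on the Hilbert space `ℂ^d`. -/
def operatorNorm {d : ℕ} (M : Matrix (Fin d) (Fin d) ℂ) : ℝ :=
  ‖Matrix.toEuclideanCLM (𝕜 := ℂ) M‖

theorem uniformPureState_isProbabilityMeasure (d : ℕ) (hd : 1 ≤ d) :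
    IsProbabilityMeasure (uniformPureState d) := by
  have : Nonempty (Fin d × Fin d) := ⟨(⟨0, hd⟩, ⟨0, hd⟩)⟩
  refine ⟨?_⟩
  have h : (Measure.addHaar : Measure (BipartiteSpace d)).toSphere Set.univ ≠ 0 :=
    Measure.measure_univ_ne_zero.2 (Measure.addHaar : Measure (BipartiteSpace d)).toSphere_ne_zero
  simp only [uniformPureState, Measure.smul_apply, smul_eq_mul]
  exact ENNReal.inv_mul_cancel h (measure_ne_top _ _)

/-- The action of a unitary operator on pure states. -/
def unitaryAction {d : ℕ} (U : BipartiteSpace d ≃ₗᵢ[ℂ] BipartiteSpace d) (ψ : PureState d) :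
    PureState d :=
  ⟨U ψ, by simp⟩

theorem uniformPureState_map_unitary (d : ℕ) (U : BipartiteSpace d ≃ₗᵢ[ℂ] BipartiteSpace d) :
    (uniformPureState d).map (unitaryAction U) = uniformPureState d := by
  have hU : Measurable (unitaryAction U) :=
    (Continuous.subtype_mk (U.continuous.comp continuous_subtype_val) _).measurable
  have hmap : (Measure.addHaar : Measure (BipartiteSpace d)).map U = Measure.addHaar := by
    have hhaar : ((Measure.addHaar : Measure (BipartiteSpace d)).map U).IsAddHaarMeasure :=
      U.toContinuousLinearEquiv.isAddHaarMeasure_map Measure.addHaar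
    obtain ⟨c, hc⟩ : ∃ c : NNReal, (Measure.addHaar : Measure (BipartiteSpace d)).map U =
        c • (Measure.addHaar : Measure (BipartiteSpace d)) :=
      ⟨_, Measure.isAddLeftInvariant_eq_smul _ _⟩
    have hball := congrArg (fun m : Measure (BipartiteSpace d) => m (Metric.ball 0 1)) hc
    simp only [Measure.smul_apply, ENNReal.smul_def, smul_eq_mul] at hball
    rw [Measure.map_apply U.continuous.measurable Metric.isOpen_ball.measurableSet,
      U.preimage_ball, map_zero] at hball
    have h0 : (Measure.addHaar : Measure (BipartiteSpace d)) (Metric.ball 0 1) ≠ 0 :=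
      (Metric.measure_ball_pos _ _ one_pos).ne'
    have h1 : (Measure.addHaar : Measure (BipartiteSpace d)) (Metric.ball 0 1) ≠ ⊤ :=
      measure_ball_lt_top.ne
    have hc1 : c = 1 := by
      rw [← ENNReal.coe_inj, ← ENNReal.mul_left_inj h0 h1, ENNReal.coe_one, one_mul]
      exact hball.symm
    rw [hc, hc1, one_smul]
  have hs : (Measure.addHaar : Measure (BipartiteSpace d)).toSphere.map (unitaryAction U) =
      (Measure.addHaar : Measure (BipartiteSpace d)).toSphere := by
    ext s hs
    rw [Measure.map_apply hU hs, Measure.toSphere_apply' _ (hU hs), Measure.toSphere_apply' _ hs]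
    congr 1
    conv_rhs => rw [← hmap]
    have hemb : MeasurableEmbedding (U : BipartiteSpace d → BipartiteSpace d) :=
      U.toHomeomorph.measurableEmbedding
    rw [hemb.map_apply]
    congr 1
    ext x
    simp only [Set.mem_smul, Set.mem_image, Set.mem_preimage]
    constructor
    · rintro ⟨r, hr, _, ⟨ψ, hψ, rfl⟩, rfl⟩
      exact ⟨r, hr, U ψ, ⟨unitaryAction U ψ, hψ, rfl⟩, (U.toLinearEquiv.map_smul_of_tower r _).symm⟩
    · rintro ⟨r, hr, _, ⟨ψ, hψ, rfl⟩, hx⟩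
      have hψ' : unitaryAction U (unitaryAction U.symm ψ) = ψ :=
        Subtype.ext (U.apply_symm_apply _)
      refine ⟨r, hr, U.symm ψ, ⟨unitaryAction U.symm ψ, by rwa [hψ'], rfl⟩, U.injective ?_⟩
      rw [← hx]
      exact (U.toLinearEquiv.map_smul_of_tower r _).trans
        (congrArg (r • ·) (U.apply_symm_apply _))
  rw [uniformPureState, Measure.map_smul, hs]

end

/-! The bound is Markov's inequality for the moment of order `d` of `‖ψ^A‖_∞`; moments are computed
with Gaussian vectors. Write the coordinates of a vector as a matrix `G`. Then `‖ψ^A‖_∞ = ‖G‖²` is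
homogeneous of degree 2, so in polar coordinates its `k`-th moment on the sphere is the Gaussian
moment of `‖G‖^(2k)` divided by that of `‖ψ‖^(2k)`.

With normalized Gaussian measure, `‖ψ‖²` is a sum of `d²` independent exponential variables, so the
denominator is `k! · multichoose(d², k)`. The numerator is bounded by applying `G` to an independent
Gaussian vector `y`. If `u` is a unit vector with `‖G* u‖ = ‖G‖`, then `‖G y‖ ≥ |⟨G* u, y⟩|`, whence
`k! ‖G‖^(2k) ≤ E_y ‖G y‖^(2k)` (`norm_pow_mul_le_lintegral`). Averaging over `G` first gives the
double average `(k! · multichoose(d, k))²` exactly.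

Hence the moment is at most `multichoose(d, k)² / multichoose(d², k)`
(`lintegral_operatorNorm_pow_mul_le`). For `k = d`, the estimates `d! · multichoose(d², d) ≥ d^(2d)`
and `d! · multichoose(d, d)² ≤ (16d/e)^d` turn this into `γ₀^d`. -/

noncomputable section

open scoped ENNReal Nat

/-! ### Gaussian moments and product integrals -/

/-- The unnormalized Gaussian weight `exp (-‖x‖²)`. -/
def gaussianWeight {E : Type*} [NormedAddCommGroup E] (x : E) : ℝ≥0∞ :=
  ENNReal.ofReal (Real.exp (-‖x‖ ^ 2))

theorem measurable_gaussianWeight {E : Type*} [NormedAddCommGroup E] [MeasurableSpace E]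
    [OpensMeasurableSpace E] : Measurable (gaussianWeight : E → ℝ≥0∞) := by
  unfold gaussianWeight
  fun_prop

theorem gaussianWeight_toLp {ι : Type*} [Fintype ι] (y : ι → ℂ) :
    gaussianWeight (WithLp.toLp 2 y : EuclideanSpace ℂ ι) = ∏ i, gaussianWeight (y i) := by
  simp only [gaussianWeight]
  rw [← ENNReal.ofReal_prod_of_nonneg (fun _ _ => (Real.exp_pos _).le), ← Real.exp_sum,
    EuclideanSpace.norm_sq_eq, Finset.sum_neg_distrib]

/-- Up to the total mass `π`, `‖z‖²` is a standard exponential variable, whose moments are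
factorials. -/
theorem lintegral_norm_pow_mul_gaussianWeight (j : ℕ) :
    ∫⁻ z : ℂ, (‖z‖ₑ ^ 2) ^ j * gaussianWeight z = ENNReal.ofReal Real.pi * j ! := by
  have h := Complex.integral_rpow_mul_exp_neg_rpow (p := 2) (q := 2 * j) (by norm_num)
    (by linarith [(Nat.cast_nonneg j : (0 : ℝ) ≤ j)])
  have e : ((2 : ℝ) * j + 2) / 2 = j + 1 := by ring
  rw [e, Real.Gamma_nat_eq_factorial, mul_div_cancel_left₀ _ (two_ne_zero)] at h
  have hpos : 0 < Real.pi * (j ! : ℝ) := mul_pos Real.pi_pos (by exact_mod_cast j.factorial_pos)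
  have hint : Integrable fun x : ℂ => ‖x‖ ^ (2 * (j : ℝ)) * Real.exp (-‖x‖ ^ (2 : ℝ)) := by
    -- A non-integrable function has integral `0` by convention, but the value found is positive.
    by_contra hc
    rw [integral_undef hc] at h
    exact hpos.ne h
  rw [← ENNReal.ofReal_natCast, ← ENNReal.ofReal_mul Real.pi_pos.le, ← h,
    ofReal_integral_eq_lintegral_ofReal hint
      (Filter.Eventually.of_forall fun x => by positivity)]
  refine lintegral_congr fun z => ?_
  rw [gaussianWeight, ENNReal.ofReal_mul (by positivity), ← pow_mul, ← ofReal_norm,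
    ← ENNReal.ofReal_pow (norm_nonneg z)]
  congr 2
  · rw [← Real.rpow_natCast]; push_cast; rfl
  · rw [← Real.rpow_natCast]; norm_num

theorem lintegral_fin_prod_eq_prod {Y : Type*} [MeasurableSpace Y] (ν : Measure Y) [SigmaFinite ν]
    {n : ℕ} {f : Fin n → Y → ℝ≥0∞} (hf : ∀ i, Measurable (f i)) :
    ∫⁻ y : Fin n → Y, ∏ i, f i (y i) ∂(Measure.pi fun _ => ν) = ∏ i, ∫⁻ y, f i y ∂ν := by
  induction n with
  | zero => simp
  | succ n ih =>
    rw [((measurePreserving_piFinSuccAbove (fun _ : Fin (n + 1) => ν) 0).symm).lintegral_map_equiv]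
    simp_rw [MeasurableEquiv.piFinSuccAbove_symm_apply, Fin.insertNthEquiv,
      Fin.prod_univ_succ, Fin.insertNth_zero, Equiv.coe_fn_mk, Fin.cons_succ, Fin.cons_zero]
    refine (lintegral_prod_mul (μ := ν) (ν := Measure.pi fun _ : Fin n => ν)
      (g := fun y : Fin n → Y => ∏ i, f i.succ (y i)) (hf 0).aemeasurable ?_).trans ?_
    · exact (Finset.measurable_prod _ fun i _ =>
        (hf i.succ).comp (measurable_pi_apply i)).aemeasurable
    · rw [← ih fun i => hf i.succ]

theorem lintegral_fintype_prod_eq_prod {ι Y : Type*} [Fintype ι] [MeasurableSpace Y]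
    (ν : Measure Y) [SigmaFinite ν] {f : ι → Y → ℝ≥0∞} (hf : ∀ i, Measurable (f i)) :
    ∫⁻ y : ι → Y, ∏ i, f i (y i) ∂(Measure.pi fun _ => ν) = ∏ i, ∫⁻ y, f i y ∂ν := by
  let e := (Fintype.equivFin ι).symm
  rw [(measurePreserving_piCongrLeft (fun _ : ι => ν) e).lintegral_map_equiv]
  simp_rw [← e.prod_comp, MeasurableEquiv.coe_piCongrLeft, Equiv.piCongrLeft_apply_apply]
  exact lintegral_fin_prod_eq_prod ν fun i => hf _

theorem card_piAntidiag_univ (ι : Type*) [Fintype ι] [DecidableEq ι] (k : ℕ) :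
    (Finset.piAntidiag (Finset.univ : Finset ι) k).card = (Fintype.card ι).multichoose k := by
  rw [← Finset.map_sym_eq_piAntidiag, Finset.card_map, Finset.sym_univ, Finset.card_univ,
    Sym.card_sym_eq_multichoose]

/-- Moments of a sum of independent variables with the moments of an exponential variable. -/
theorem lintegral_sum_pow_mul_prod {ι Y : Type*} [Fintype ι] [MeasurableSpace Y]
    (ν : Measure Y) [SigmaFinite ν] {h w : Y → ℝ≥0∞} (hh : Measurable h) (hw : Measurable w)
    {m c : ℝ≥0∞} (hm : ∀ j : ℕ, ∫⁻ y, h y ^ j * w y ∂ν = m * c ^ j * j !) (k : ℕ) :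
    ∫⁻ y : ι → Y, (∑ i, h (y i)) ^ k * ∏ i, w (y i) ∂(Measure.pi fun _ => ν) =
      m ^ Fintype.card ι * c ^ k * (k ! * (Fintype.card ι).multichoose k) := by
  classical
  simp_rw [Finset.sum_pow_eq_sum_piAntidiag, Finset.sum_mul, mul_assoc, ← Finset.prod_mul_distrib]
  have hmeas : ∀ (a : ι → ℕ) i, Measurable fun y => h y ^ a i * w y := fun a i =>
    (hh.pow_const _).mul hw
  have hmeas' : ∀ a : ι → ℕ, Measurable fun y : ι → Y => ∏ i, h (y i) ^ a i * w (y i) := fun a =>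
    Finset.measurable_prod _ fun i _ => (hmeas a i).comp (measurable_pi_apply i)
  rw [lintegral_finsetSum _ fun a _ => (hmeas' a).const_mul _]
  -- The multinomial coefficient cancels the factorials `∏ (a i)!` down to `k!`, so all exponent
  -- vectors contribute equally and it remains to count them.
  have hterm : ∀ a ∈ Finset.piAntidiag (Finset.univ : Finset ι) k,
      ∫⁻ y : ι → Y, (Nat.multinomial Finset.univ a : ℝ≥0∞) * ∏ i, h (y i) ^ a i * w (y i)
        ∂(Measure.pi fun _ => ν) = m ^ Fintype.card ι * c ^ k * k ! := by
    intro a ha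
    have ha' : ∑ i, a i = k := (Finset.mem_piAntidiag.1 ha).1
    have hspec := Nat.multinomial_spec Finset.univ a
    rw [lintegral_const_mul _ (hmeas' a), lintegral_fintype_prod_eq_prod ν (hmeas a)]
    simp_rw [hm]
    rw [Finset.prod_mul_distrib, Finset.prod_mul_distrib, Finset.prod_const, Finset.card_univ,
      Finset.prod_pow_eq_pow_sum, ha']
    rw [ha'] at hspec
    rw [← hspec]
    push_cast
    ring
  rw [Finset.sum_congr rfl hterm, Finset.sum_const, card_piAntidiag_univ, nsmul_eq_mul]
  ring

/-! ### Linear changes of variables and rotation invariance -/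

/-- Uniqueness of Haar measure. The constant does not depend on `f`, so it can be cancelled or
identified by comparing integrals, and no determinant is needed. -/
theorem lintegral_comp_continuousLinearEquiv {Y E : Type*} [NormedAddCommGroup Y]
    [NormedSpace ℝ Y] [MeasurableSpace Y] [BorelSpace Y] [FiniteDimensional ℝ Y]
    [NormedAddCommGroup E] [NormedSpace ℝ E] [MeasurableSpace E] [BorelSpace E]
    [FiniteDimensional ℝ E] (L : Y ≃L[ℝ] E) (ν : Measure Y) [ν.IsAddHaarMeasure]
    (μ : Measure E) [μ.IsAddHaarMeasure] :
    ∃ c : ℝ≥0∞, ∀ f : E → ℝ≥0∞, ∫⁻ y, f (L y) ∂ν = c * ∫⁻ x, f x ∂μ := by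
  have : (ν.map L).IsAddHaarMeasure := L.isAddHaarMeasure_map ν
  obtain ⟨c, hc⟩ : ∃ c : NNReal, ν.map L = c • μ := ⟨_, Measure.isAddLeftInvariant_eq_smul _ _⟩
  refine ⟨c, fun f => ?_⟩
  have h := lintegral_map_equiv (μ := ν) f L.toHomeomorph.toMeasurableEquiv
  rw [← smul_eq_mul, ← ENNReal.smul_def, ← lintegral_smul_measure, ← hc]
  exact h.symm

/-- The unit ball is preserved, which forces the Haar constant to be `1`. -/
theorem lintegral_comp_linearIsometryEquiv {E : Type*}
    [NormedAddCommGroup E] [NormedSpace ℝ E] [MeasurableSpace E] [BorelSpace E]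
    [FiniteDimensional ℝ E] (U : E ≃ₗᵢ[ℝ] E) (μ : Measure E) [μ.IsAddHaarMeasure]
    (f : E → ℝ≥0∞) : ∫⁻ x, f (U x) ∂μ = ∫⁻ x, f x ∂μ := by
  obtain ⟨c, hc⟩ := lintegral_comp_continuousLinearEquiv U.toContinuousLinearEquiv μ μ
  have h := hc ((Metric.ball 0 1).indicator 1)
  have h1 : ∀ x, (Metric.ball (0 : E) 1).indicator (1 : E → ℝ≥0∞)
      (U.toContinuousLinearEquiv x) = (Metric.ball (0 : E) 1).indicator 1 x := fun x => by
    simp [Set.indicator]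
  simp_rw [h1, lintegral_indicator_one Metric.isOpen_ball.measurableSet] at h
  have hc1 : c = 1 := by
    rw [← ENNReal.mul_left_inj (Metric.measure_ball_pos μ (0 : E) one_pos).ne'
      measure_ball_lt_top.ne, one_mul]
    exact h.symm
  have := hc f
  rwa [hc1, one_mul] at this

/-- The real continuous linear identification of `ℂ^ι` with Euclidean space. -/
abbrev euclideanRealEquiv (ι : Type*) [Fintype ι] : (ι → ℂ) ≃L[ℝ] EuclideanSpace ℂ ι :=
  (PiLp.continuousLinearEquiv 2 ℝ fun _ : ι => ℂ).symm

theorem lintegral_coord_pow_mul_gaussianWeight {ι : Type*} [Fintype ι] (i₀ : ι) (j : ℕ) :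
    ∫⁻ y : ι → ℂ, (‖y i₀‖ₑ ^ 2) ^ j * gaussianWeight (WithLp.toLp 2 y : EuclideanSpace ℂ ι) =
      ENNReal.ofReal Real.pi ^ Fintype.card ι * j ! := by
  classical
  have hm : ∀ i, Measurable fun z : ℂ => (if i = i₀ then (‖z‖ₑ ^ 2) ^ j else 1) * gaussianWeight z :=
    fun i => by
      split_ifs
      · exact ((measurable_enorm.pow_const _).pow_const _).mul measurable_gaussianWeight
      · exact measurable_gaussianWeight.const_mul _
  have h := lintegral_fintype_prod_eq_prod (volume : Measure ℂ) hm
  simp_rw [Finset.prod_mul_distrib, Finset.prod_ite_eq' Finset.univ i₀ (fun _ => _),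
    if_pos (Finset.mem_univ i₀), ← gaussianWeight_toLp] at h
  rw [volume_pi, h]
  have hi : ∀ i, ∫⁻ z : ℂ, (if i = i₀ then (‖z‖ₑ ^ 2) ^ j else 1) * gaussianWeight z =
      ENNReal.ofReal Real.pi * if i = i₀ then (j ! : ℝ≥0∞) else 1 := fun i => by
    split_ifs
    · exact lintegral_norm_pow_mul_gaussianWeight j
    · simpa using lintegral_norm_pow_mul_gaussianWeight 0
  simp_rw [hi]
  rw [Finset.prod_mul_distrib, Finset.prod_const, Finset.card_univ, Finset.prod_ite_eq',
    if_pos (Finset.mem_univ i₀)]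

theorem exists_norm_eq_one_smul {ι : Type*} [Fintype ι] [Nonempty ι] (v : EuclideanSpace ℂ ι) :
    ∃ u : EuclideanSpace ℂ ι, ‖u‖ = 1 ∧ v = (‖v‖ : ℂ) • u := by
  rcases eq_or_ne v 0 with rfl | hv
  · obtain ⟨u, hu⟩ := exists_norm_eq (EuclideanSpace ℂ ι) zero_le_one
    exact ⟨u, hu, by simp⟩
  · have hv' : (‖v‖ : ℂ) ≠ 0 := by simpa using hv
    refine ⟨(‖v‖ : ℂ)⁻¹ • v, by simp [norm_smul, hv], ?_⟩
    rw [smul_smul, mul_inv_cancel₀ hv', one_smul]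

/-- The Gaussian weight is rotation invariant, so the direction of `v` may be rotated to a
coordinate axis; only `‖v‖` survives. -/
theorem lintegral_inner_pow_mul_gaussianWeight {ι : Type*} [Fintype ι]
    (v : EuclideanSpace ℂ ι) (j : ℕ) :
    ∫⁻ y : ι → ℂ, (‖inner ℂ v (WithLp.toLp 2 y)‖ₑ ^ 2) ^ j *
        gaussianWeight (WithLp.toLp 2 y : EuclideanSpace ℂ ι) =
      ENNReal.ofReal Real.pi ^ Fintype.card ι * (‖v‖ₑ ^ 2) ^ j * j ! := by
  classical
  rcases isEmpty_or_nonempty ι with hι | ⟨⟨i₀⟩⟩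
  · have hv : v = 0 := Subsingleton.elim _ _
    subst hv
    rcases j with _ | j <;> simp [gaussianWeight_toLp, volume_pi]
  have : Nonempty ι := ⟨i₀⟩
  obtain ⟨u, hu, hv⟩ := exists_norm_eq_one_smul v
  obtain ⟨b, hb⟩ := Orthonormal.exists_orthonormalBasis_extension_of_card_eq
    (𝕜 := ℂ) (E := EuclideanSpace ℂ ι) (ι := ι) (by simp) (v := fun _ => u) (s := {i₀})
    (by
      refine ⟨fun _ => hu, fun i j hij => (hij (Subsingleton.elim _ _)).elim⟩)
  have hbu : b i₀ = u := hb i₀ rfl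
  let U : EuclideanSpace ℂ ι ≃ₗᵢ[ℝ] EuclideanSpace ℂ ι :=
    { b.repr.toLinearEquiv.restrictScalars ℝ with norm_map' := b.repr.norm_map }
  have hU : ∀ x, U x i₀ = inner ℂ u x := fun x => by
    rw [← hbu]; exact b.repr_apply_apply x i₀
  obtain ⟨c, hc⟩ := lintegral_comp_continuousLinearEquiv (euclideanRealEquiv ι)
    (volume : Measure (ι → ℂ)) (Measure.addHaar : Measure (EuclideanSpace ℂ ι))
  have h1 : ∀ x : EuclideanSpace ℂ ι,
      (‖inner ℂ v x‖ₑ ^ 2) ^ j * gaussianWeight x =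
        (‖v‖ₑ ^ 2) ^ j * ((‖U x i₀‖ₑ ^ 2) ^ j * gaussianWeight (U x)) := fun x => by
    have hg : gaussianWeight (U x) = gaussianWeight x := by
      simp only [gaussianWeight, U.norm_map]
    have hn : ‖inner ℂ v x‖ₑ = ‖v‖ₑ * ‖inner ℂ u x‖ₑ := by
      conv_lhs => rw [hv]
      rw [inner_smul_left, enorm_mul]
      simp [← ofReal_norm]
    rw [hg, hU, hn]
    ring
  calc _ = c * ∫⁻ x : EuclideanSpace ℂ ι, (‖inner ℂ v x‖ₑ ^ 2) ^ j * gaussianWeight x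
        ∂Measure.addHaar := hc fun x => (‖inner ℂ v x‖ₑ ^ 2) ^ j * gaussianWeight x
    _ = (‖v‖ₑ ^ 2) ^ j * (c * ∫⁻ x : EuclideanSpace ℂ ι,
          (‖x i₀‖ₑ ^ 2) ^ j * gaussianWeight x ∂Measure.addHaar) := by
      simp_rw [h1]
      rw [lintegral_const_mul' _ _ (by finiteness),
        lintegral_comp_linearIsometryEquiv U Measure.addHaar
          fun x : EuclideanSpace ℂ ι => (‖x i₀‖ₑ ^ 2) ^ j * gaussianWeight x]
      ring
    _ = (‖v‖ₑ ^ 2) ^ j * ∫⁻ y : ι → ℂ, (‖y i₀‖ₑ ^ 2) ^ j *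
          gaussianWeight (WithLp.toLp 2 y : EuclideanSpace ℂ ι) := by
      rw [← hc]
      rfl
    _ = _ := by
      rw [lintegral_coord_pow_mul_gaussianWeight]
      ring

/-! ### From Gaussian vectors to the uniform sphere -/

/-- Polar coordinates: a homogeneous function integrated against the Gaussian weight. -/
theorem lintegral_toSphere_mul_lintegral {E : Type*}
    [NormedAddCommGroup E] [NormedSpace ℝ E] [MeasurableSpace E] [BorelSpace E]
    [FiniteDimensional ℝ E] [Nontrivial E] (μ : Measure E) [μ.IsAddHaarMeasure]
    {F : E → ℝ≥0∞} (hF : Measurable F) {k : ℕ}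
    (hom : ∀ (r : ℝ) (x : E), 0 < r → F (r • x) = (‖r‖ₑ ^ 2) ^ k * F x) :
    ∫⁻ x, F x * gaussianWeight x ∂μ = (∫⁻ s, F s ∂μ.toSphere) *
      ∫⁻ r, (‖(r : ℝ)‖ₑ ^ 2) ^ k * gaussianWeight (r : ℝ)
        ∂(Measure.volumeIoiPow (Module.finrank ℝ E - 1)) := by
  have hmp := (μ.measurePreserving_homeomorphUnitSphereProd).symm
    (homeomorphUnitSphereProd E).toMeasurableEquiv
  have hs : MeasurableSet ({0}ᶜ : Set E) := (measurableSet_singleton 0).compl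
  rw [← lintegral_prod_mul (f := fun s : Metric.sphere (0 : E) 1 => F s)
    (g := fun r : Set.Ioi (0 : ℝ) => (‖(r : ℝ)‖ₑ ^ 2) ^ k * gaussianWeight (r : ℝ))]
  -- The origin is a null set, so polar coordinates on its complement suffice.
  · have hres : ∫⁻ x, F x * gaussianWeight x ∂μ =
        ∫⁻ x : ({0}ᶜ : Set E), F x * gaussianWeight (x : E) ∂(μ.comap Subtype.val) := by
      rw [lintegral_subtype_comap hs fun x => F x * gaussianWeight x, restrict_compl_singleton]
    rw [hres,
      hmp.lintegral_map_equiv (fun x : ({0}ᶜ : Set E) => F x * gaussianWeight (x : E))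
        (homeomorphUnitSphereProd E).toMeasurableEquiv.symm]
    refine lintegral_congr fun a => ?_
    have ha : (((homeomorphUnitSphereProd E).toMeasurableEquiv.symm a : ({0}ᶜ : Set E)) : E) =
        (a.2 : ℝ) • (a.1 : E) := homeomorphUnitSphereProd_symm_apply_coe E a
    have hn : ‖(a.2 : ℝ) • (a.1 : E)‖ = ‖(a.2 : ℝ)‖ := by
      rw [norm_smul, norm_eq_of_mem_sphere, mul_one]
    rw [ha, hom _ _ a.2.2]
    simp only [gaussianWeight, hn]
    ring
  · exact (hF.comp measurable_subtype_coe).aemeasurable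
  · exact (((measurable_subtype_coe.enorm.pow_const _).pow_const _).mul
      (measurable_gaussianWeight.comp measurable_subtype_coe)).aemeasurable

/-- `F` and `‖x‖^(2k)` have the same degree and hence the same radial integral, which therefore
never has to be evaluated. -/
theorem lintegral_uniformPureState_mul {d : ℕ} (hd : 1 ≤ d) {F : BipartiteSpace d → ℝ≥0∞}
    (hF : Measurable F) {k : ℕ}
    (hom : ∀ (r : ℝ) (x : BipartiteSpace d), 0 < r → F (r • x) = (‖r‖ₑ ^ 2) ^ k * F x) :
    (∫⁻ ψ, F ψ ∂(uniformPureState d)) *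
        ∫⁻ x : BipartiteSpace d, (‖x‖ₑ ^ 2) ^ k * gaussianWeight x ∂Measure.addHaar =
      ∫⁻ x : BipartiteSpace d, F x * gaussianWeight x ∂Measure.addHaar := by
  have : Nonempty (Fin d × Fin d) := ⟨(⟨0, hd⟩, ⟨0, hd⟩)⟩
  rw [lintegral_toSphere_mul_lintegral Measure.addHaar hF hom,
    lintegral_toSphere_mul_lintegral (F := fun x : BipartiteSpace d => (‖x‖ₑ ^ 2) ^ k)
      Measure.addHaar ((measurable_enorm.pow_const _).pow_const _)
      (fun r x _ => by rw [enorm_smul]; ring)]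
  have h1 : ∀ s : Metric.sphere (0 : BipartiteSpace d) 1,
      (‖(s : BipartiteSpace d)‖ₑ ^ 2) ^ k = 1 := fun s => by
    rw [← ofReal_norm, norm_eq_of_mem_sphere]; simp
  simp_rw [h1]
  rw [lintegral_const, one_mul, uniformPureState, lintegral_smul_measure, smul_eq_mul]
  have h : (Measure.addHaar : Measure (BipartiteSpace d)).toSphere Set.univ ≠ 0 :=
    Measure.measure_univ_ne_zero.2 (Measure.addHaar : Measure (BipartiteSpace d)).toSphere_ne_zero
  rw [mul_mul_mul_comm, ENNReal.inv_mul_cancel h (measure_ne_top _ _), one_mul]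

theorem enorm_toLp_sq {ι : Type*} [Fintype ι] (y : ι → ℂ) :
    ‖(WithLp.toLp 2 y : EuclideanSpace ℂ ι)‖ₑ ^ 2 = ∑ i, ‖y i‖ₑ ^ 2 := by
  rw [← ofReal_norm, ← ENNReal.ofReal_pow (norm_nonneg _), EuclideanSpace.norm_sq_eq,
    ENNReal.ofReal_sum_of_nonneg fun _ _ => sq_nonneg _]
  simp only [ENNReal.ofReal_pow (norm_nonneg _), ofReal_norm]

theorem lintegral_norm_toLp_pow_mul_gaussianWeight (ι : Type*) [Fintype ι] (k : ℕ) :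
    ∫⁻ y : ι → ℂ, (‖(WithLp.toLp 2 y : EuclideanSpace ℂ ι)‖ₑ ^ 2) ^ k *
        gaussianWeight (WithLp.toLp 2 y : EuclideanSpace ℂ ι) =
      ENNReal.ofReal Real.pi ^ Fintype.card ι * (k ! * (Fintype.card ι).multichoose k) := by
  simp_rw [enorm_toLp_sq, gaussianWeight_toLp]
  have h := lintegral_sum_pow_mul_prod (ι := ι) (volume : Measure ℂ)
    (h := fun z : ℂ => ‖z‖ₑ ^ 2) (measurable_enorm.pow_const 2) measurable_gaussianWeight
    (m := ENNReal.ofReal Real.pi) (c := 1)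
    (fun j => by rw [one_pow, mul_one]; exact lintegral_norm_pow_mul_gaussianWeight j) k
  rwa [one_pow, mul_one] at h

/-! ### Gaussian matrices and their operator norm -/

variable {d : ℕ}

/-- The pure state vector whose coordinates are the entries of a matrix. -/
def vectorOfMatrix (G : Fin d → Fin d → ℂ) : BipartiteSpace d := WithLp.toLp 2 fun p => G p.1 p.2

theorem gaussianWeight_vectorOfMatrix (G : Fin d → Fin d → ℂ) :
    gaussianWeight (vectorOfMatrix G) =
      ∏ i, gaussianWeight (WithLp.toLp 2 (G i) : EuclideanSpace ℂ (Fin d)) := by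
  rw [vectorOfMatrix, gaussianWeight_toLp, Fintype.prod_prod_type]
  simp_rw [gaussianWeight_toLp]

/-- The operator with matrix `G`. -/
abbrev matrixOperator (G : Fin d → Fin d → ℂ) :
    EuclideanSpace ℂ (Fin d) →L[ℂ] EuclideanSpace ℂ (Fin d) :=
  Matrix.toEuclideanCLM (𝕜 := ℂ) (Matrix.of G)

theorem operatorNorm_reducedState_vectorOfMatrix (G : Fin d → Fin d → ℂ) :
    operatorNorm (reducedState (vectorOfMatrix G)) = ‖matrixOperator G‖ ^ 2 := by
  have h : reducedState (vectorOfMatrix G) = Matrix.of G * star (Matrix.of G) := by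
    ext i j
    simp [reducedState, partialTraceB, densityMatrix, vectorOfMatrix, Matrix.mul_apply]
  rw [operatorNorm, h, map_mul, map_star]
  exact (CStarRing.norm_self_mul_star (x := matrixOperator G)).trans (sq _).symm

/-- The unit sphere is compact, so the norm of the adjoint is attained. -/
theorem exists_norm_adjoint_apply_eq (hd : 1 ≤ d)
    (T : EuclideanSpace ℂ (Fin d) →L[ℂ] EuclideanSpace ℂ (Fin d)) :
    ∃ u, ‖u‖ = 1 ∧ ‖(ContinuousLinearMap.adjoint T) u‖ = ‖T‖ := by
  have : Nonempty (Fin d) := ⟨⟨0, hd⟩⟩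
  have hne : (Metric.sphere (0 : EuclideanSpace ℂ (Fin d)) 1).Nonempty :=
    (exists_norm_eq _ zero_le_one).imp fun u hu => by simpa using hu
  obtain ⟨u, hu, hmax⟩ := (isCompact_sphere (0 : EuclideanSpace ℂ (Fin d)) 1).exists_isMaxOn hne
    (f := fun x => ‖(ContinuousLinearMap.adjoint T) x‖) (by fun_prop)
  have hu1 : ‖u‖ = 1 := by simpa using hu
  have hT : ‖ContinuousLinearMap.adjoint T‖ = ‖T‖ := LinearIsometryEquiv.norm_map _ T
  refine ⟨u, hu1, le_antisymm ?_ ?_⟩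
  · have := (ContinuousLinearMap.adjoint T).le_opNorm u
    rwa [hu1, mul_one, hT] at this
  · rw [← hT]
    refine ContinuousLinearMap.opNorm_le_of_unit_norm (norm_nonneg _) fun x hx => ?_
    exact hmax (by simpa using hx)

/-- Replaces the supremum in the operator norm by an average: for `u` attaining `‖T*‖`,
Cauchy–Schwarz gives `‖T y‖ ≥ |⟨T* u, y⟩|`, and the right side has known Gaussian moments. -/
theorem norm_pow_mul_le_lintegral (hd : 1 ≤ d)
    (T : EuclideanSpace ℂ (Fin d) →L[ℂ] EuclideanSpace ℂ (Fin d)) (k : ℕ) :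
    (‖T‖ₑ ^ 2) ^ k * (ENNReal.ofReal Real.pi ^ d * k !) ≤
      ∫⁻ y : Fin d → ℂ, (‖T (WithLp.toLp 2 y)‖ₑ ^ 2) ^ k *
        gaussianWeight (WithLp.toLp 2 y : EuclideanSpace ℂ (Fin d)) := by
  obtain ⟨u, hu, hT⟩ := exists_norm_adjoint_apply_eq hd T
  have h := lintegral_inner_pow_mul_gaussianWeight ((ContinuousLinearMap.adjoint T) u) k
  rw [Fintype.card_fin, ← ofReal_norm ((ContinuousLinearMap.adjoint T) u), hT, ofReal_norm] at h
  calc _ = ENNReal.ofReal Real.pi ^ d * (‖T‖ₑ ^ 2) ^ k * k ! := by ring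
    _ = _ := h.symm
    _ ≤ _ := by
      refine lintegral_mono fun y => ?_
      have hle : ‖inner ℂ ((ContinuousLinearMap.adjoint T) u) (WithLp.toLp 2 y)‖ₑ ≤
          ‖T (WithLp.toLp 2 y)‖ₑ := by
        rw [ContinuousLinearMap.adjoint_inner_left, ← ofReal_norm, ← ofReal_norm]
        refine ENNReal.ofReal_le_ofReal ?_
        simpa [hu] using norm_inner_le_norm (𝕜 := ℂ) u (T (WithLp.toLp 2 y))
      dsimp only
      gcongr

/-- The coordinates of `G χ` come from the independent rows of `G`, so `‖G χ‖²` is a sum of `d`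
independent exponential variables scaled by `‖χ‖²`. -/
theorem lintegral_norm_matrixOperator_apply_pow (χ : EuclideanSpace ℂ (Fin d)) (k : ℕ) :
    ∫⁻ G : Fin d → Fin d → ℂ, (‖matrixOperator G χ‖ₑ ^ 2) ^ k * gaussianWeight (vectorOfMatrix G) =
      (ENNReal.ofReal Real.pi ^ d) ^ d * (‖χ‖ₑ ^ 2) ^ k * (k ! * d.multichoose k) := by
  -- Conjugated because the inner product is conjugate-linear in its first argument.
  let v : EuclideanSpace ℂ (Fin d) := WithLp.toLp 2 fun j => star (χ j)
  have hv : ‖v‖ₑ ^ 2 = ‖χ‖ₑ ^ 2 := by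
    have : χ = WithLp.toLp 2 fun j => χ j := rfl
    rw [this]
    simp only [v, enorm_toLp_sq]
    simp [← ofReal_norm]
  have hrow : ∀ G : Fin d → Fin d → ℂ, ‖matrixOperator G χ‖ₑ ^ 2 =
      ∑ i, ‖inner ℂ v (WithLp.toLp 2 (G i))‖ₑ ^ 2 := fun G => by
    have : matrixOperator G χ = WithLp.toLp 2 (Matrix.mulVec (Matrix.of G) χ.ofLp) := rfl
    rw [this, enorm_toLp_sq]
    refine Finset.sum_congr rfl fun i _ => ?_
    simp [v, Matrix.mulVec, dotProduct, PiLp.inner_apply]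
  simp_rw [hrow, gaussianWeight_vectorOfMatrix]
  have hmeas : Measurable fun y : Fin d → ℂ => (WithLp.toLp 2 y : EuclideanSpace ℂ (Fin d)) :=
    (euclideanRealEquiv (Fin d)).continuous.measurable
  have h := lintegral_sum_pow_mul_prod (ι := Fin d) (volume : Measure (Fin d → ℂ))
    (h := fun y => ‖inner ℂ v (WithLp.toLp 2 y)‖ₑ ^ 2)
    (w := fun y => gaussianWeight (WithLp.toLp 2 y : EuclideanSpace ℂ (Fin d)))
    ((((innerSL ℂ v).continuous.measurable).comp hmeas).enorm.pow_const 2)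
    (measurable_gaussianWeight.comp hmeas)
    (fun j => lintegral_inner_pow_mul_gaussianWeight v j) k
  rwa [Fintype.card_fin, hv] at h

/-- The real continuous linear identification of matrices with bipartite vectors. -/
def matrixEquivVector (d : ℕ) : (Fin d → Fin d → ℂ) ≃L[ℝ] BipartiteSpace d :=
  LinearEquiv.toContinuousLinearEquiv
    { toFun := vectorOfMatrix
      invFun := fun ψ i j => ψ (i, j)
      map_add' := fun _ _ => rfl
      map_smul' := fun _ _ => rfl
      left_inv := fun _ => rfl
      right_inv := fun _ => rfl }

instance isAddHaarMeasure_volume_matrix :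
    (volume : Measure (Fin d → Fin d → ℂ)).IsAddHaarMeasure :=
  Measure.pi.isAddHaarMeasure fun _ => (volume : Measure (Fin d → ℂ))

theorem measurable_vectorOfMatrix : Measurable (vectorOfMatrix (d := d)) :=
  (matrixEquivVector d).continuous.measurable

theorem continuous_matrixOperator : Continuous (matrixOperator (d := d)) := by
  have : Continuous (((Matrix.toEuclideanCLM (𝕜 := ℂ) (n := Fin d)).toAlgEquiv.toLinearMap) :
      Matrix (Fin d) (Fin d) ℂ → _) := LinearMap.continuous_of_finiteDimensional _
  exact this

theorem continuous_operatorNorm_reducedState :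
    Continuous fun ψ : BipartiteSpace d => operatorNorm (reducedState ψ) := by
  have h : (fun ψ : BipartiteSpace d => operatorNorm (reducedState ψ)) =
      fun ψ => ‖matrixOperator ((matrixEquivVector d).symm ψ)‖ ^ 2 := funext fun ψ =>
    operatorNorm_reducedState_vectorOfMatrix ((matrixEquivVector d).symm ψ)
  rw [h]
  exact (continuous_matrixOperator.comp (matrixEquivVector d).symm.continuous).norm.pow 2

theorem lintegral_norm_matrixOperator_pow_le (hd : 1 ≤ d) (k : ℕ) :
    ∫⁻ G : Fin d → Fin d → ℂ, (‖matrixOperator G‖ₑ ^ 2) ^ k * gaussianWeight (vectorOfMatrix G) ≤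
      (ENNReal.ofReal Real.pi ^ d) ^ d * (k ! * d.multichoose k ^ 2) := by
  have hpi : ENNReal.ofReal Real.pi ≠ 0 := by simp [Real.pi_pos]
  have ha0 : ENNReal.ofReal Real.pi ^ d * (k ! : ℝ≥0∞) ≠ 0 :=
    mul_ne_zero (pow_ne_zero _ hpi) (by exact_mod_cast k.factorial_ne_zero)
  have ha : ENNReal.ofReal Real.pi ^ d * (k ! : ℝ≥0∞) ≠ ⊤ := by finiteness
  -- The extra factor is the moment that pays for the auxiliary Gaussian vector `y`.
  rw [← ENNReal.mul_le_mul_iff_left ha0 ha, ← lintegral_mul_const' _ _ ha]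
  have hmeas : Measurable fun y : Fin d → ℂ => (WithLp.toLp 2 y : EuclideanSpace ℂ (Fin d)) :=
    (euclideanRealEquiv (Fin d)).continuous.measurable
  calc _ ≤ ∫⁻ G : Fin d → Fin d → ℂ, ∫⁻ y : Fin d → ℂ,
        (‖matrixOperator G (WithLp.toLp 2 y)‖ₑ ^ 2) ^ k *
          gaussianWeight (WithLp.toLp 2 y : EuclideanSpace ℂ (Fin d)) *
            gaussianWeight (vectorOfMatrix G) := by
        refine lintegral_mono fun G => ?_
        dsimp only
        rw [lintegral_mul_const' _ _ (by unfold gaussianWeight; finiteness), mul_right_comm]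
        gcongr
        exact norm_pow_mul_le_lintegral hd _ k
    _ = ∫⁻ y : Fin d → ℂ, ∫⁻ G : Fin d → Fin d → ℂ,
        (‖matrixOperator G (WithLp.toLp 2 y)‖ₑ ^ 2) ^ k *
          gaussianWeight (WithLp.toLp 2 y : EuclideanSpace ℂ (Fin d)) *
            gaussianWeight (vectorOfMatrix G) := by
        refine lintegral_lintegral_swap (Measurable.aemeasurable ?_)
        have h1 : Measurable fun p : (Fin d → Fin d → ℂ) × (Fin d → ℂ) =>
            matrixOperator p.1 (WithLp.toLp 2 p.2) := by
          refine Continuous.measurable (Continuous.clm_apply ?_ ?_)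
          · exact continuous_matrixOperator.comp continuous_fst
          · exact (euclideanRealEquiv (Fin d)).continuous.comp continuous_snd
        exact (((h1.enorm.pow_const _).pow_const _).mul
          (measurable_gaussianWeight.comp (hmeas.comp measurable_snd))).mul
          (measurable_gaussianWeight.comp (measurable_vectorOfMatrix.comp measurable_fst))
    _ = ∫⁻ y : Fin d → ℂ, ((ENNReal.ofReal Real.pi ^ d) ^ d * (k ! * d.multichoose k)) *
        ((‖(WithLp.toLp 2 y : EuclideanSpace ℂ (Fin d))‖ₑ ^ 2) ^ k *
          gaussianWeight (WithLp.toLp 2 y : EuclideanSpace ℂ (Fin d))) := by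
        refine lintegral_congr fun y => ?_
        simp_rw [mul_right_comm _ (gaussianWeight (WithLp.toLp 2 y : EuclideanSpace ℂ (Fin d)))]
        rw [lintegral_mul_const' _ _ (by unfold gaussianWeight; finiteness),
          lintegral_norm_matrixOperator_apply_pow]
        ring
    _ = _ := by
        rw [lintegral_const_mul' _ _ (by finiteness), lintegral_norm_toLp_pow_mul_gaussianWeight,
          Fintype.card_fin]
        ring

theorem lintegral_norm_vectorOfMatrix_pow (k : ℕ) :
    ∫⁻ G : Fin d → Fin d → ℂ, (‖vectorOfMatrix G‖ₑ ^ 2) ^ k * gaussianWeight (vectorOfMatrix G) =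
      ENNReal.ofReal Real.pi ^ (d * d) * (k ! * (d * d).multichoose k) := by
  obtain ⟨a, ha⟩ := lintegral_comp_continuousLinearEquiv (euclideanRealEquiv (Fin d × Fin d))
    (volume : Measure (Fin d × Fin d → ℂ)) (Measure.addHaar : Measure (BipartiteSpace d))
  obtain ⟨b, hb⟩ := lintegral_comp_continuousLinearEquiv (matrixEquivVector d)
    (volume : Measure (Fin d → Fin d → ℂ)) (Measure.addHaar : Measure (BipartiteSpace d))
  have h1 := fun k => lintegral_norm_toLp_pow_mul_gaussianWeight (Fin d × Fin d) k
  have ha' := fun k => (ha fun x => (‖x‖ₑ ^ 2) ^ k * gaussianWeight x).symm.trans (h1 k)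
  have hb0 : ∫⁻ G : Fin d → Fin d → ℂ, gaussianWeight (vectorOfMatrix G) =
      ENNReal.ofReal Real.pi ^ (d * d) := by
    have := lintegral_norm_matrixOperator_apply_pow (0 : EuclideanSpace ℂ (Fin d)) 0
    simpa [pow_mul] using this
  have hb' := (hb fun x => gaussianWeight x).symm.trans hb0
  simp only [Fintype.card_prod, Fintype.card_fin] at ha'
  -- Both coordinate systems give the Gaussian the same total mass, the case `k = 0`.
  have hab : a = b := by
    have h := ha' 0
    simp only [pow_zero, one_mul, Nat.factorial_zero, Nat.cast_one, Nat.multichoose_zero_right,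
      mul_one] at h
    have hpi : ENNReal.ofReal Real.pi ^ (d * d) ≠ 0 := by simp [Real.pi_pos]
    have hpi' : ENNReal.ofReal Real.pi ^ (d * d) ≠ ⊤ := by finiteness
    have hI0 : ∫⁻ x : BipartiteSpace d, gaussianWeight x ∂Measure.addHaar ≠ 0 := fun h0 =>
      hpi (by rw [← h, h0, mul_zero])
    have ha0 : a ≠ 0 := fun h0 => hpi (by rw [← h, h0, zero_mul])
    have hIt : ∫⁻ x : BipartiteSpace d, gaussianWeight x ∂Measure.addHaar ≠ ⊤ := fun h0 =>
      hpi' (by rw [← h, h0, ENNReal.mul_top ha0])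
    rw [← ENNReal.mul_left_inj hI0 hIt, h, hb']
  rw [← ha' k, hab]
  exact hb fun x => (‖x‖ₑ ^ 2) ^ k * gaussianWeight x

/-! ### Moments of the reduced state -/

theorem ofReal_operatorNorm_reducedState_smul (r : ℝ) (ψ : BipartiteSpace d) :
    ENNReal.ofReal (operatorNorm (reducedState (r • ψ))) =
      ‖r‖ₑ ^ 2 * ENNReal.ofReal (operatorNorm (reducedState ψ)) := by
  have h : reducedState (r • ψ) = ((r ^ 2 : ℝ) : ℂ) • reducedState ψ := by
    ext i j
    simp only [reducedState, partialTraceB, densityMatrix, Matrix.of_apply, Matrix.smul_apply,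
      PiLp.smul_apply, Complex.real_smul, star_mul', smul_eq_mul, Finset.mul_sum]
    refine Finset.sum_congr rfl fun k _ => ?_
    simp only [Complex.star_def, Complex.conj_ofReal]
    push_cast
    ring
  rw [operatorNorm, h, map_smul, norm_smul, ENNReal.ofReal_mul (norm_nonneg _), operatorNorm]
  congr 1
  rw [Complex.norm_real, norm_pow, ENNReal.ofReal_pow (norm_nonneg _), ofReal_norm]

theorem lintegral_operatorNorm_pow_mul_le (hd : 1 ≤ d) (k : ℕ) :
    (∫⁻ ψ : PureState d, ENNReal.ofReal (operatorNorm (reducedState (ψ : BipartiteSpace d))) ^ k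
      ∂(uniformPureState d)) * (d * d).multichoose k ≤ (d.multichoose k : ℝ≥0∞) ^ 2 := by
  obtain ⟨c, hc⟩ := lintegral_comp_continuousLinearEquiv (matrixEquivVector d)
    (volume : Measure (Fin d → Fin d → ℂ)) (Measure.addHaar : Measure (BipartiteSpace d))
  have h := lintegral_uniformPureState_mul hd (k := k)
    (F := fun ψ => ENNReal.ofReal (operatorNorm (reducedState ψ)) ^ k)
    (continuous_operatorNorm_reducedState.measurable.ennreal_ofReal.pow_const k)
    (fun r x _ => by rw [ofReal_operatorNorm_reducedState_smul, mul_pow])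
  -- Multiplying by the Haar constant turns both Gaussian integrals into integrals over matrices.
  have h' := congrArg (c * ·) h
  simp only [mul_left_comm c] at h'
  rw [← hc, ← hc] at h'
  have hle := lintegral_norm_matrixOperator_pow_le hd k
  have hpow : ∀ G : Fin d → Fin d → ℂ,
      ENNReal.ofReal (operatorNorm (reducedState (matrixEquivVector d G))) =
        ‖matrixOperator G‖ₑ ^ 2 := fun G => by
    rw [← ofReal_norm, ← ENNReal.ofReal_pow (norm_nonneg _),
      ← operatorNorm_reducedState_vectorOfMatrix]
    rfl
  simp only [hpow] at h'
  have hb : ENNReal.ofReal Real.pi ^ (d * d) * (k ! : ℝ≥0∞) ≠ 0 :=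
    mul_ne_zero (by simp [Real.pi_pos]) (by exact_mod_cast k.factorial_ne_zero)
  have hb' : ENNReal.ofReal Real.pi ^ (d * d) * (k ! : ℝ≥0∞) ≠ ⊤ := by finiteness
  rw [← ENNReal.mul_le_mul_iff_right hb hb']
  calc _ = (∫⁻ ψ : PureState d, ENNReal.ofReal (operatorNorm (reducedState
          (ψ : BipartiteSpace d))) ^ k ∂(uniformPureState d)) *
          (ENNReal.ofReal Real.pi ^ (d * d) * (k ! * (d * d).multichoose k)) := by ring
    _ = ∫⁻ G : Fin d → Fin d → ℂ, (‖matrixOperator G‖ₑ ^ 2) ^ k *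
          gaussianWeight (vectorOfMatrix G) := by
        rw [← lintegral_norm_vectorOfMatrix_pow]
        exact h'
    _ ≤ _ := hle
    _ = _ := by rw [← pow_mul]; ring

/-! ### Numerical estimates -/

theorem pow_le_factorial_mul_multichoose (n k : ℕ) : n ^ k ≤ k ! * n.multichoose k := by
  rw [Nat.multichoose_eq, ← Nat.ascFactorial_eq_factorial_mul_choose']
  exact Nat.pow_succ_le_ascFactorial n k

/-- `multichoose n n` is half the central binomial coefficient for `n ≥ 1`, and inherits its
recursion. -/
theorem multichoose_self_succ (n : ℕ) :
    (n + 2) * (n + 2).multichoose (n + 2) = 2 * (2 * n + 3) * (n + 1).multichoose (n + 1) := by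
  simp only [Nat.multichoose_eq]
  have h1 := Nat.succ_mul_centralBinom_succ (n + 1)
  have h2 := Nat.centralBinom_eq_two_mul_choose (n + 1)
  have h3 := Nat.centralBinom_eq_two_mul_choose (n + 2)
  have h4 : (2 * (n + 1)).choose (n + 1) = 2 * (n + 1 + (n + 1) - 1).choose (n + 1) := by
    have : 2 * (n + 1) = 2 * n + 1 + 1 := by ring
    rw [this, Nat.choose_succ_succ, Nat.choose_symm_half]
    have e : n + 1 + (n + 1) - 1 = 2 * n + 1 := by omega
    rw [e, ← Nat.choose_symm_half]
    ring
  have h5 : (2 * (n + 2)).choose (n + 2) = 2 * (n + 2 + (n + 2) - 1).choose (n + 2) := by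
    have : 2 * (n + 2) = 2 * (n + 1) + 1 + 1 := by ring
    rw [this, Nat.choose_succ_succ, Nat.choose_symm_half]
    have e : n + 2 + (n + 2) - 1 = 2 * (n + 1) + 1 := by omega
    rw [e, ← Nat.choose_symm_half]
    ring
  have h6 : n + 1 + 1 = n + 2 := rfl
  rw [h6] at h1
  rw [h2, h3, h4, h5] at h1
  nlinarith [h1]

/-- Both sides are compared with `exp (1 - 1/(n+2))`: the right through `log x ≥ 1 - 1/x`, the left
through `1 - s ≤ exp (-s)` at `s = 1/(2(n+2))`, squared. -/
theorem exp_one_mul_sq_le (n : ℕ) :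
    Real.exp 1 * ((2 * n + 3) ^ 2 / (4 * (n + 2) ^ 2)) ≤ ((n + 2 : ℝ) / (n + 1)) ^ (n + 1) := by
  have hn : (0 : ℝ) ≤ n := Nat.cast_nonneg n
  have hx : (0 : ℝ) < (n + 2) / (n + 1) := by positivity
  have hlog := Real.one_sub_inv_le_log_of_pos hx
  have h1 : Real.exp (1 - 1 / (n + 2)) ≤ ((n + 2 : ℝ) / (n + 1)) ^ (n + 1) := by
    rw [← Real.exp_log (pow_pos hx _), Real.log_pow]
    refine Real.exp_le_exp.2 ?_
    calc (1 : ℝ) - 1 / (n + 2) = ((n + 1 : ℕ) : ℝ) * (1 - ((n + 2 : ℝ) / (n + 1))⁻¹) := by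
          push_cast
          field_simp
          ring
      _ ≤ _ := by gcongr
  have h2 : ((2 * n + 3 : ℝ) ^ 2 / (4 * (n + 2) ^ 2)) ≤ Real.exp (-(1 / (n + 2))) := by
    have h3 : (2 * n + 3 : ℝ) / (2 * (n + 2)) ≤ Real.exp (-(1 / (2 * (n + 2)))) := by
      refine le_trans (le_of_eq ?_) (Real.add_one_le_exp _)
      field_simp
      ring
    calc ((2 * n + 3 : ℝ) ^ 2 / (4 * (n + 2) ^ 2)) = ((2 * n + 3 : ℝ) / (2 * (n + 2))) ^ 2 := by
          rw [div_pow, mul_pow]; norm_num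
      _ ≤ Real.exp (-(1 / (2 * (n + 2)))) ^ 2 := by gcongr
      _ = _ := by
          rw [← Real.exp_nat_mul]
          congr 1
          push_cast
          field_simp
  calc _ ≤ Real.exp 1 * Real.exp (-(1 / (n + 2))) := by gcongr
    _ = Real.exp (1 - 1 / (n + 2)) := by rw [← Real.exp_add, sub_eq_add_neg]
    _ ≤ _ := h1

/-- Induction on consecutive ratios; `exp_one_mul_sq_le` says exactly that the left side grows no
faster than the right. -/
theorem factorial_mul_multichoose_self_sq_le (n : ℕ) :
    ((n + 1)! : ℝ) * ((n + 1).multichoose (n + 1) : ℝ) ^ 2 ≤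
      (16 * (n + 1) / Real.exp 1) ^ (n + 1) := by
  induction n with
  | zero =>
    have := Real.exp_one_lt_d9
    have h : Real.exp 1 ≤ 16 := by linarith
    simpa using (one_le_div (Real.exp_pos 1)).2 h
  | succ n ih =>
    have hn : (0 : ℝ) ≤ n := Nat.cast_nonneg n
    have hrec : ((n + 2 : ℝ)) * ((n + 2).multichoose (n + 2) : ℝ) =
        2 * (2 * n + 3) * ((n + 1).multichoose (n + 1) : ℝ) := by
      exact_mod_cast multichoose_self_succ n
    have hrec' : ((n + 2).multichoose (n + 2) : ℝ) =
        2 * (2 * n + 3) / (n + 2) * ((n + 1).multichoose (n + 1) : ℝ) := by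
      field_simp
      linarith
    have hfac : ((n + 2)! : ℝ) = (n + 2) * (n + 1)! := by
      rw [Nat.factorial_succ]; push_cast; ring
    have key := exp_one_mul_sq_le n
    have he := Real.exp_pos 1
    change ((n + 2)! : ℝ) * ((n + 2).multichoose (n + 2) : ℝ) ^ 2 ≤ _
    rw [hrec', hfac]
    calc _ = (4 * (2 * n + 3) ^ 2 / (n + 2)) *
          (((n + 1)! : ℝ) * ((n + 1).multichoose (n + 1) : ℝ) ^ 2) := by
          field_simp
          ring
      _ ≤ (4 * (2 * n + 3) ^ 2 / (n + 2)) * (16 * (n + 1) / Real.exp 1) ^ (n + 1) := by gcongr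
      _ = (16 * (n + 2) / Real.exp 1) * (Real.exp 1 * ((2 * n + 3) ^ 2 / (4 * (n + 2) ^ 2))) *
          (16 * (n + 1) / Real.exp 1) ^ (n + 1) := by
          congr 1
          field_simp
          ring
      _ ≤ (16 * (n + 2) / Real.exp 1) * ((n + 2 : ℝ) / (n + 1)) ^ (n + 1) *
          (16 * (n + 1) / Real.exp 1) ^ (n + 1) := by gcongr
      _ = (16 * (n + 2) / Real.exp 1) ^ (n + 2) := by
          rw [mul_assoc, ← mul_pow, pow_succ' _ (n + 1)]
          congr 2
          field_simp
      _ = _ := by push_cast; ring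

/-! ### The moment of order `d` and the tail bound -/

theorem lintegral_operatorNorm_pow_le (hd : 1 ≤ d) :
    ∫⁻ ψ : PureState d, ENNReal.ofReal (operatorNorm (reducedState (ψ : BipartiteSpace d))) ^ d
      ∂(uniformPureState d) ≤ ENNReal.ofReal ((16 / (Real.exp 1 * d)) ^ d) := by
  have h := lintegral_operatorNorm_pow_mul_le hd d
  have hd0 : (0 : ℝ) < d := by exact_mod_cast hd
  have hnum : (d ! : ℝ) * (d.multichoose d : ℝ) ^ 2 ≤ (16 * d / Real.exp 1) ^ d := by
    obtain ⟨n, rfl⟩ := Nat.exists_eq_add_of_le' hd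
    simpa using factorial_mul_multichoose_self_sq_le n
  have hp0 : ((d * d : ℕ) : ℝ≥0∞) ^ d ≠ 0 := by
    have : d ≠ 0 := by omega
    simp [this]
  have hp : ((d * d : ℕ) : ℝ≥0∞) ^ d ≠ ⊤ := by finiteness
  rw [← ENNReal.mul_le_mul_iff_left hp0 hp]
  calc _ ≤ (∫⁻ ψ : PureState d, ENNReal.ofReal (operatorNorm (reducedState
          (ψ : BipartiteSpace d))) ^ d ∂(uniformPureState d)) *
            (d ! * (d * d).multichoose d) := by
        gcongr
        exact_mod_cast pow_le_factorial_mul_multichoose (d * d) d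
    _ = d ! * ((∫⁻ ψ : PureState d, ENNReal.ofReal (operatorNorm (reducedState
          (ψ : BipartiteSpace d))) ^ d ∂(uniformPureState d)) * (d * d).multichoose d) := by ring
    _ ≤ d ! * (d.multichoose d : ℝ≥0∞) ^ 2 := by gcongr
    _ = ENNReal.ofReal ((d ! : ℝ) * (d.multichoose d : ℝ) ^ 2) := by
        rw [ENNReal.ofReal_mul (by positivity), ENNReal.ofReal_pow (by positivity),
          ENNReal.ofReal_natCast, ENNReal.ofReal_natCast]
    _ ≤ ENNReal.ofReal ((16 * d / Real.exp 1) ^ d) := ENNReal.ofReal_le_ofReal hnum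
    _ = ENNReal.ofReal ((16 / (Real.exp 1 * d)) ^ d * ((d * d : ℕ) : ℝ) ^ d) := by
        rw [← mul_pow]
        congr 2
        push_cast
        field_simp
    _ = _ := by
        rw [ENNReal.ofReal_mul (by positivity), ENNReal.ofReal_pow (Nat.cast_nonneg (d * d)),
          ENNReal.ofReal_natCast]

end

theorem mainTheorem8 (d : ℕ) (hd : 1 ≤ d) (ε : ℝ) :
    uniformPureState d
        {ψ : PureState d |
          16 / (Real.exp 1 * d) * Real.exp ε ≤ operatorNorm (reducedState (ψ : BipartiteSpace d))}
      ≤ ENNReal.ofReal (Real.exp (-(d * ε))) := by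
  have hd0 : (0 : ℝ) < d := by exact_mod_cast hd
  have ht : 0 < 16 / (Real.exp 1 * d) * Real.exp ε := by positivity
  set t := 16 / (Real.exp 1 * d) * Real.exp ε with ht_def
  have hT0 : ENNReal.ofReal t ^ d ≠ 0 := pow_ne_zero _ (ENNReal.ofReal_pos.2 ht).ne'
  have hT : ENNReal.ofReal t ^ d ≠ ⊤ := by finiteness
  have hmarkov : ENNReal.ofReal t ^ d * uniformPureState d
      {ψ : PureState d | t ≤ operatorNorm (reducedState (ψ : BipartiteSpace d))} ≤
      ∫⁻ ψ : PureState d, ENNReal.ofReal (operatorNorm (reducedState (ψ : BipartiteSpace d))) ^ d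
        ∂(uniformPureState d) := by
    refine le_trans ?_ (mul_meas_ge_le_lintegral
      ((continuous_operatorNorm_reducedState.comp
        continuous_subtype_val).measurable.ennreal_ofReal.pow_const d) (ENNReal.ofReal t ^ d))
    gcongr ENNReal.ofReal t ^ d * uniformPureState _ ?_
    intro ψ hψ
    exact pow_le_pow_left₀ zero_le (ENNReal.ofReal_le_ofReal hψ) d
  rw [← ENNReal.mul_le_mul_iff_right hT0 hT]
  refine (hmarkov.trans (lintegral_operatorNorm_pow_le hd)).trans (le_of_eq ?_)
  -- `(γ₀ e^ε)^d · e^(-dε) = γ₀^d`, for `ε` of either sign.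
  rw [← ENNReal.ofReal_pow ht.le, ← ENNReal.ofReal_mul (by positivity)]
  congr 1
  rw [ht_def, mul_pow, ← Real.exp_nat_mul, mul_assoc, ← Real.exp_add]
  simp
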